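/- Let $\mathbb F_q$ be a finite field, let $K_1,\dots,K_n$ be non-empty subsets of $\mathbb F_q$, $d_i=|K_i|$, and let $\mathcal X=K_1\times\cdots\times K_n$, $m=|\mathcal X|=\prod_{i=1}^n d_i$. Let $s\in\{1,\dots,n\}$, let $\delta$ be an integer with $2\le\delta\le d_s$, and put $r=d_s-\delta+1\ge 1$. For an integer $d\ge 0$ let $\mathcal D^{(\delta,s)}_{\mathcal X}(d)\subseteq\mathbb F_q^m$ be the code consisting of the vectors $(f(\alpha))_{\alpha\in\mathcal X}$, where $f$ runs over the polynomials in $\mathbb F_q[X_1,\dots,X_n]$ of total degree at most $d$ with $\deg_{X_s}f<d_s-\delta+1$, together with $f=0$. Put $$\tilde d=\sum_{i\ne s}(d_i-1)+d_s-\delta .$$ A linear code $\mathcal C\subseteq\mathbb F_q^m$ is called $(r,\delta)$-locally recoverable (for $r\ge1$, $\delta\ge2$, $r+\delta-1\le m$) if every position lies in a set $S$ of at most $r+\delta-1$ positions such that the code obtained from $\mathcal C$ by removing the entries outside $S$ has minimum distance at least $\delta$. Such a code, of dimension $k$, is called optimal if its minimum distance is equal to the bound of Prakash et al., $$m-k-\left(\left\lceil\frac{k}{r}\right\rceil-1\right)(\delta-1)+1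 .$$ Then: 1. $\mathcal D^{(\delta,s)}_{\mathcal X}(\tilde d)$ is an optimal $(r,\delta)$-locally recoverable code, and its minimum distance is $\delta$. 2. If $\tilde d\ge 1$ (which holds whenever $n\ge2$ and all $d_i\ge2$), then $\mathcal D^{(\delta,s)}_{\mathcal X}(\tilde d-1)$ is an optimal $(r,\delta)$-locally recoverable code, and if moreover $r\ge2$, that is, $\delta<d_s$, its minimum distance is $\delta+1$. -/

import Mathlib

namespace CartesianCode

/-- The minimum distance of a code `C ⊆ F^ι`: the least Hamming distance between two distinct
codewords. It is `⊤` for a code with only one codeword. -/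
noncomputable def minDist {F : Type*} [Field F] [DecidableEq F] {ι : Type*} [Fintype ι]
    (C : Submodule F (ι → F)) : ℕ∞ :=
  ⨅ (u : ι → F) (_ : u ∈ C) (v : ι → F) (_ : v ∈ C) (_ : u ≠ v), (hammingDist u v : ℕ∞)

/-- The punctured code obtained from `C` by removing the entries that are not in `S`. -/
def puncture {F : Type*} [Field F] {ι : Type*} (C : Submodule F (ι → F)) (S : Finset ι) :
    Submodule F (S → F) :=
  C.map (LinearMap.funLeft F F (Subtype.val : S → ι))

/-- `C` is `(r, δ)`-locally recoverable. -/
def IsLocallyRecoverable {F : Type*} [Field F] [DecidableEq F] {ι : Type*} [Fintype ι]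
    (C : Submodule F (ι → F)) (r δ : ℕ) : Prop :=
  1 ≤ r ∧ 2 ≤ δ ∧ r + δ - 1 ≤ Fintype.card ι ∧
    ∀ i : ι, ∃ S : Finset ι, i ∈ S ∧ S.card ≤ r + δ - 1 ∧ (δ : ℕ∞) ≤ minDist (puncture C S)

/-- The Prakash et al. upper bound for the minimum distance of an `(r, δ)`-locally recoverable
code of length `m` and dimension `k`: `m - k - (⌈k / r⌉ - 1) (δ - 1) + 1`. -/
def prakashBound (m k r δ : ℕ) : ℤ :=
  (m : ℤ) - k - (⌈(k : ℚ) / (r : ℚ)⌉ - 1) * ((δ : ℤ) - 1) + 1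

/-- `C` is an optimal `(r, δ)`-locally recoverable code: it is `(r, δ)`-locally recoverable
and its minimum distance is equal to the Prakash bound. -/
def IsOptimal {F : Type*} [Field F] [DecidableEq F] {ι : Type*} [Fintype ι]
    (C : Submodule F (ι → F)) (r δ : ℕ) : Prop :=
  IsLocallyRecoverable C r δ ∧
    ∃ w : ℕ, minDist C = (w : ℕ∞) ∧
      (w : ℤ) = prakashBound (Fintype.card ι) (Module.finrank F C) r δ

/-- The cartesian product `K₁ × ⋯ × Kₙ ⊆ Fⁿ`. -/
def cartesian {F : Type*} {n : ℕ} (K : Fin n → Finset F) : Finset (Fin n → F) :=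
  Fintype.piFinset K

/-- The evaluation morphism `f ↦ (f(α))_{α ∈ X}`; the positions of a codeword are
indexed by the points of `X` themselves. -/
noncomputable def evalMap {F : Type*} [Field F] {n : ℕ} (X : Finset (Fin n → F)) :
    MvPolynomial (Fin n) F →ₗ[F] (X → F) :=
  LinearMap.pi fun α => (MvPolynomial.aeval (α : Fin n → F)).toLinearMap

/-- The polynomials `f` of degree at most `d` such that the degree of `f` in the variable `X_s`
is less than `|K_s| - δ + 1` (an integer, possibly nonpositive), together with the zero
polynomial. -/
noncomputable def polySpace {F : Type*} [Field F] {n : ℕ} (K : Fin n → Finset F) (δ : ℕ)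
    (s : Fin n) (d : ℕ) : Submodule F (MvPolynomial (Fin n) F) where
  carrier := {f | f = 0 ∨
    (f.totalDegree ≤ d ∧ (f.degreeOf s : ℤ) < ((K s).card : ℤ) - (δ : ℤ) + 1)}
  zero_mem' := Or.inl rfl
  add_mem' := by
    rintro f g (rfl | ⟨hf, hf'⟩) (rfl | ⟨hg, hg'⟩)
    · exact Or.inl (add_zero 0)
    · rw [zero_add]
      exact Or.inr ⟨hg, hg'⟩
    · rw [add_zero]
      exact Or.inr ⟨hf, hf'⟩
    · refine Or.inr ⟨(MvPolynomial.totalDegree_add f g).trans (max_le hf hg), ?_⟩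
      have h := MvPolynomial.degreeOf_add_le s f g
      rcases le_max_iff.mp h with h | h <;> omega
  smul_mem' := by
    rintro c f (rfl | ⟨hf, hf'⟩)
    · exact Or.inl (smul_zero c)
    · refine Or.inr ⟨(MvPolynomial.totalDegree_smul_le c f).trans hf, ?_⟩
      have h := MvPolynomial.degreeOf_C_mul_le f s c
      rw [MvPolynomial.smul_eq_C_mul]
      omega

/-- The `(δ, s)`-quasi affine cartesian code of order `d` defined over `K₁, …, Kₙ`. -/
noncomputable def quasiAffineCode {F : Type*} [Field F] {n : ℕ} (K : Fin n → Finset F) (δ : ℕ)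
    (s : Fin n) (d : ℕ) : Submodule F (cartesian K → F) :=
  (polySpace K δ s d).map (evalMap (cartesian K))

/-- The number `∑_{i ≠ s} (|K_i| - 1) + |K_s| - δ`. No subtraction is truncated
when all `K_i` are nonempty and `δ ≤ |K_s|`. -/
def dTilde {F : Type*} {n : ℕ} (K : Fin n → Finset F) (δ : ℕ) (s : Fin n) : ℕ :=
  (∑ i ∈ Finset.univ.erase s, ((K i).card - 1)) + ((K s).card - δ)

end CartesianCode

/-!
A polynomial of small degree in `X s` restricts to a univariate polynomial of small degree on each
line in direction `s`, so a codeword that is nonzero somewhere on such a line has at least `δ`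
nonzero entries on it. This gives the locality, the bound `δ` for the minimum distance, and the fact
that a codeword is determined by its entries on a thin grid, where `K s` is replaced by a subset of
`r = |K s| - δ + 1` elements. The monomials that are reduced on the thin grid have degree at most
`dTilde`, and only the largest of them reaches it; so the dimension at order `dTilde` is the size of
the thin grid, and at order `dTilde - 1` it is smaller by at most one.

For order `dTilde - 1` the distance grows by the punctured combinatorial Nullstellensatz: no
polynomial of degree less than `dTilde` is nonzero at exactly one point of a thin grid. So a
codeword supported on one line has at least `δ + 1` nonzero entries, and any other nonzero codeword
has at least `2 * δ`. Since the distances at the two orders differ, so do the dimensions.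
-/

namespace CartesianCode

open Finset Function MvPolynomial

section Grid

theorem degree_strictMono {σ : Type*} : StrictMono (Finsupp.degree : (σ →₀ ℕ) → ℕ) := by
  intro e t h
  rw [← tsub_add_cancel_of_le h.le, map_add]
  refine Nat.lt_add_of_pos_left (Nat.pos_of_ne_zero fun h0 => h.not_ge ?_)
  exact tsub_eq_zero_iff_le.mp ((Finsupp.degree_eq_zero_iff _).mp h0)

variable {ι R : Type*} [Fintype ι] [CommRing R]

/-- The product of all `X i - a` with `a ∈ T i`. Its nonzeros on the grid `∏ K i` form the
subgrid `∏ (K i \ T i)`, which makes it the source of codewords of small weight. -/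
noncomputable def vanishingProduct (T : ι → Finset R) : MvPolynomial ι R :=
  ∏ i, ∏ a ∈ T i, (X i - C a)

theorem eval_vanishingProduct_ne_zero_iff [IsDomain R] {T : ι → Finset R} {x : ι → R} :
    eval x (vanishingProduct T) ≠ 0 ↔ ∀ i, x i ∉ T i := by
  simp only [vanishingProduct, map_prod, map_sub, eval_X, eval_C, prod_ne_zero_iff, sub_ne_zero,
    mem_univ, forall_const]
  exact forall_congr' fun i => ⟨fun h hx => h _ hx rfl, fun h a ha hxa => h (hxa ▸ ha)⟩

theorem totalDegree_vanishingProduct_le [Nontrivial R] (T : ι → Finset R) :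
    (vanishingProduct T).totalDegree ≤ ∑ i, #(T i) := by
  refine (totalDegree_finsetProd _ _).trans (sum_le_sum fun i _ => ?_)
  calc (∏ a ∈ T i, (X i - C a : MvPolynomial ι R)).totalDegree
      ≤ ∑ a ∈ T i, (X i - C a : MvPolynomial ι R).totalDegree := totalDegree_finsetProd _ _
    _ ≤ ∑ a ∈ T i, 1 := sum_le_sum fun a _ =>
        (totalDegree_sub_C_le _ _).trans (totalDegree_X i).le
    _ = #(T i) := (card_eq_sum_ones _).symm

theorem degreeOf_vanishingProduct_le [Nontrivial R] (T : ι → Finset R) (s : ι) :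
    (vanishingProduct T).degreeOf s ≤ #(T s) := by
  classical
  have degreeOf_factor (i : ι) (a : R) :
      degreeOf s (X i - C a : MvPolynomial ι R) ≤ if i = s then 1 else 0 := by
    refine (degreeOf_sub_le s _ _).trans ?_
    simp [degreeOf_X, degreeOf_C, eq_comm]
  calc (vanishingProduct T).degreeOf s
      ≤ ∑ i, ∑ a ∈ T i, degreeOf s (X i - C a : MvPolynomial ι R) :=
        (degreeOf_prod_le _ _ _).trans (sum_le_sum fun i _ => degreeOf_prod_le _ _ _)
    _ ≤ ∑ i, ∑ a ∈ T i, if i = s then 1 else 0 :=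
        sum_le_sum fun i _ => sum_le_sum fun a _ => degreeOf_factor i a
    _ = #(T s) := by simp

theorem coeff_vanishingProduct [IsDomain R] {T : ι → Finset R} {t : ι →₀ ℕ}
    (ht : ∀ i, t i = #(T i)) : (vanishingProduct T).coeff t = 1 := by
  let : LinearOrder ι := WellOrderingRel.isWellOrder.linearOrder
  let m : MonomialOrder ι := MonomialOrder.degLex
  have hmonic : m.Monic (vanishingProduct T) :=
    .prod fun i _ => .prod fun a _ => m.monic_X_sub_C i a
  have hdegree : m.degree (vanishingProduct T) = t := by
    classical
    rw [vanishingProduct, m.degree_prod fun i _ =>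
      prod_ne_zero_iff.mpr fun a _ => (m.monic_X_sub_C i a).ne_zero]
    simp_rw [m.degree_prod fun a _ => (m.monic_X_sub_C _ a).ne_zero, m.degree_X_sub_C]
    ext i
    simp [Finsupp.finsetSum_apply, Finsupp.single_apply, ht]
  rwa [← hdegree]

/-- The exponent of the largest monomial that is reduced on the grid `∏ K i`. -/
noncomputable def topExponent {α : Type*} (K : ι → Finset α) : ι →₀ ℕ :=
  Finsupp.equivFunOnFinite.symm fun i => #(K i) - 1

@[simp]
theorem topExponent_apply {α : Type*} (K : ι → Finset α) (i : ι) :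
    topExponent K i = #(K i) - 1 := rfl

theorem degree_topExponent {α : Type*} (K : ι → Finset α) :
    (topExponent K).degree = ∑ i, (#(K i) - 1) := by
  simp [Finsupp.degree_eq_sum]

theorem lt_card_of_le_topExponent {α : Type*} {K : ι → Finset α} (hK : ∀ i, (K i).Nonempty)
    {e : ι →₀ ℕ} (he : e ≤ topExponent K) (i : ι) : e i < #(K i) :=
  (he i).trans_lt (Nat.sub_one_lt (hK i).card_ne_zero)

theorem topExponent_mono {α : Type*} {K T : ι → Finset α} (h : ∀ i, T i ⊆ K i) :
    topExponent T ≤ topExponent K := fun i => Nat.sub_le_sub_right (card_le_card (h i)) 1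

variable [DecidableEq ι]

theorem card_Iic_topExponent {α : Type*} {K : ι → Finset α} (hK : ∀ i, (K i).Nonempty) :
    #(Iic (topExponent K)) = ∏ i, #(K i) := by
  rw [Finsupp.card_Iic, prod_subset (subset_univ _) fun i _ hi => by
    simp [Finsupp.notMem_support_iff.mp hi]]
  refine prod_congr rfl fun i _ => ?_
  rw [Nat.card_Iic, topExponent_apply, Nat.sub_add_cancel (hK i).card_pos]

theorem exists_mem_piFinset_eval_ne_zero [IsDomain R] {K : ι → Finset R}
    (hK : ∀ i, (K i).Nonempty) {g : MvPolynomial ι R} (hcoeff : g.coeff (topExponent K) ≠ 0)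
    (hg : g.totalDegree ≤ (topExponent K).degree) : ∃ x ∈ Fintype.piFinset K, eval x g ≠ 0 := by
  have hdegree : g.totalDegree = (topExponent K).degree :=
    hg.antisymm (le_totalDegree (mem_support_iff.mpr hcoeff))
  obtain ⟨x, hx, hgx⟩ := combinatorial_nullstellensatz_exists_eval_nonzero g _ hcoeff hdegree K
    (lt_card_of_le_topExponent hK le_rfl)
  exact ⟨x, Fintype.mem_piFinset.mpr hx, hgx⟩

/-- Otherwise a combination of `f` with a `vanishingProduct` would vanish on the whole grid, against
the combinatorial Nullstellensatz. -/
theorem degree_topExponent_le_totalDegree [IsDomain R] {K : ι → Finset R} {f : MvPolynomial ι R}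
    {x : ι → R} (hx : x ∈ Fintype.piFinset K) (hfx : eval x f ≠ 0)
    (hf : ∀ y ∈ Fintype.piFinset K, y ≠ x → eval y f = 0) :
    (topExponent K).degree ≤ f.totalDegree := by
  classical
  by_contra! hlt
  have hxK := Fintype.mem_piFinset.mp hx
  set v := vanishingProduct fun i => (K i).erase (x i) with hv
  have hcoeff_v : v.coeff (topExponent K) = 1 :=
    coeff_vanishingProduct fun i => by rw [topExponent_apply, card_erase_of_mem (hxK i)]
  have hdegree_v : v.totalDegree ≤ (topExponent K).degree := by
    rw [degree_topExponent]
    exact (totalDegree_vanishingProduct_le _).trans_eq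
      (sum_congr rfl fun i _ => card_erase_of_mem (hxK i))
  have hcoeff_f : f.coeff (topExponent K) = 0 :=
    notMem_support_iff.mp fun hmem => hlt.not_ge (le_totalDegree hmem)
  set g := eval x v • f - eval x f • v with hg
  have hcoeff_g : g.coeff (topExponent K) ≠ 0 := by simpa [hg, hcoeff_v, hcoeff_f] using hfx
  have hdegree_g : g.totalDegree ≤ (topExponent K).degree :=
    (totalDegree_sub _ _).trans (max_le ((totalDegree_smul_le _ _).trans hlt.le)
      ((totalDegree_smul_le _ _).trans hdegree_v))
  obtain ⟨y, hy, hgy⟩ :=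
    exists_mem_piFinset_eval_ne_zero (fun i => ⟨x i, hxK i⟩) hcoeff_g hdegree_g
  refine hgy ?_
  rcases eq_or_ne y x with rfl | hyx
  · simp [hg, mul_comm]
  · have hvy : eval y v = 0 := by
      obtain ⟨i, hi⟩ := ne_iff.mp hyx
      by_contra hne
      exact eval_vanishingProduct_ne_zero_iff.mp hne i
        (mem_erase.mpr ⟨hi, Fintype.mem_piFinset.mp hy i⟩)
    simp [hg, hvy, hf y hy hyx]

end Grid

section Line

variable {ι : Type*} [DecidableEq ι]

/-- The points with `s`-th coordinate in `A` on the line through `x` in direction `s`. -/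
def coordLine {α : Type*} (A : Finset α) (s : ι) (x : ι → α) : Finset (ι → α) :=
  A.map ⟨update x s, update_injective x s⟩

theorem mem_coordLine {α : Type*} {A : Finset α} {s : ι} {x y : ι → α} :
    y ∈ coordLine A s x ↔ y s ∈ A ∧ ∀ i ≠ s, y i = x i := by
  simp only [coordLine, mem_map, Embedding.coeFn_mk, update_eq_iff]
  grind

theorem coordLine_eq_of_mem {α : Type*} {A : Finset α} {s : ι} {x y : ι → α}
    (hy : y ∈ coordLine A s x) : coordLine A s y = coordLine A s x := by
  rw [mem_coordLine] at hy
  ext z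
  rw [mem_coordLine, mem_coordLine]
  grind

theorem card_filter_coordLine {α : Type*} (A : Finset α) (s : ι) (x : ι → α)
    (p : (ι → α) → Prop) [DecidablePred p] :
    #{y ∈ coordLine A s x | p y} = #{a ∈ A | p (update x s a)} := by
  rw [coordLine, filter_map, card_map]
  rfl

theorem coordLine_subset_piFinset [Fintype ι] {α : Type*} {K : ι → Finset α} {A : Finset α} {s : ι}
    {x : ι → α} (hA : A ⊆ K s) (hx : ∀ i ≠ s, x i ∈ K i) :
    coordLine A s x ⊆ Fintype.piFinset K := by
  intro y hy
  rw [mem_coordLine] at hy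
  rw [Fintype.mem_piFinset]
  intro i
  rcases eq_or_ne i s with rfl | hi
  · exact hA hy.1
  · exact hy.2 i hi ▸ hx i hi

variable {R : Type*}

/-- The univariate polynomial obtained from `f` by fixing all variables but `X s` to the
coordinates of `x`. -/
noncomputable def lineRestriction [CommSemiring R] (f : MvPolynomial ι R) (s : ι) (x : ι → R) :
    Polynomial R :=
  aeval (update (fun i => Polynomial.C (x i)) s Polynomial.X) f

theorem eval_lineRestriction [CommSemiring R] (f : MvPolynomial ι R) (s : ι) (x : ι → R) (a : R) :
    (lineRestriction f s x).eval a = eval (update x s a) f := by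
  rw [lineRestriction, aeval_def, polynomial_eval_eval₂, MvPolynomial.eval,
    coe_eval₂Hom]
  congr 1
  · ext
    simp
  · ext i
    rcases eq_or_ne i s with rfl | hi
    · simp
    · simp [hi]

theorem natDegree_lineRestriction_le [CommSemiring R] (f : MvPolynomial ι R) (s : ι) (x : ι → R) :
    (lineRestriction f s x).natDegree ≤ f.degreeOf s := by
  have natDegree_factor (i : ι) (k : ℕ) :
      (update (fun i => Polynomial.C (x i)) s Polynomial.X i ^ k).natDegree ≤
        if i = s then k else 0 := by
    rcases eq_or_ne i s with rfl | hi
    · simpa using Polynomial.natDegree_X_pow_le k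
    · rw [update_of_ne hi, if_neg hi, ← Polynomial.C_pow, Polynomial.natDegree_C]
  rw [lineRestriction, aeval_def, eval₂_eq]
  refine Polynomial.natDegree_sum_le_of_forall_le _ _ fun e he => ?_
  calc _ ≤ (∏ i ∈ e.support,
            update (fun i => Polynomial.C (x i)) s Polynomial.X i ^ e i).natDegree :=
        Polynomial.natDegree_C_mul_le _ _
    _ ≤ ∑ i ∈ e.support, if i = s then e i else 0 :=
        (Polynomial.natDegree_prod_le _ _).trans (sum_le_sum fun i _ => natDegree_factor i (e i))
    _ ≤ e s := by rw [sum_ite_eq']; split_ifs <;> simp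
    _ ≤ f.degreeOf s := monomial_le_degreeOf s he

theorem card_le_degreeOf_add_card_coordLine_ne_zero [CommRing R] [IsDomain R]
    [DecidableEq R] {f : MvPolynomial ι R} {x : ι → R} (hfx : eval x f ≠ 0) (A : Finset R)
    (s : ι) :
    #A ≤ f.degreeOf s + #{y ∈ coordLine A s x | eval y f ≠ 0} := by
  have hne : lineRestriction f s x ≠ 0 := fun h0 => hfx <| by
    simpa [h0] using (eval_lineRestriction f s x (x s)).symm
  have hroots : {a ∈ A | eval (update x s a) f = 0} ⊆ (lineRestriction f s x).roots.toFinset := by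
    intro a ha
    simp [hne, eval_lineRestriction, (mem_filter.mp ha).2]
  rw [card_filter_coordLine,
    ← card_filter_add_card_filter_not (s := A) fun a => eval (update x s a) f = 0]
  gcongr
  calc #{a ∈ A | eval (update x s a) f = 0}
      ≤ #(lineRestriction f s x).roots.toFinset := card_le_card hroots
    _ ≤ (lineRestriction f s x).natDegree :=
        (Multiset.toFinset_card_le _).trans (Polynomial.card_roots' _)
    _ ≤ f.degreeOf s := natDegree_lineRestriction_le f s x

end Line

section MinDist

variable {F : Type*} [Field F] {ι : Type*}

theorem hammingNorm_funLeft_val [DecidableEq F] (S : Finset ι) (c : ι → F) :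
    hammingNorm (LinearMap.funLeft F F (Subtype.val : S → ι) c) = #{i ∈ S | c i ≠ 0} := by
  change #(S.attach.filter fun i : S => c i ≠ 0) = _
  rw [filter_attach (c · ≠ 0), card_map, card_attach]

theorem finrank_le_card_of_forall_eq_zero [Finite ι] {C : Submodule F (ι → F)} (S : Finset ι)
    (hS : ∀ c ∈ C, (∀ i ∈ S, c i = 0) → c = 0) : Module.finrank F C ≤ #S := by
  let restrict := (LinearMap.funLeft F F (Subtype.val : S → ι)).domRestrict C
  have hinj : Injective restrict := by
    rw [← LinearMap.ker_eq_bot, LinearMap.ker_eq_bot']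
    exact fun c hc => Subtype.ext (hS c c.2 fun i hi => congrFun hc ⟨i, hi⟩)
  simpa using LinearMap.finrank_le_finrank_of_injective hinj

variable [Fintype ι] [DecidableEq F] {C : Submodule F (ι → F)}

theorem le_minDist {w : ℕ} (hw : ∀ c ∈ C, c ≠ 0 → w ≤ hammingNorm c) : (w : ℕ∞) ≤ minDist C := by
  refine le_iInf₂ fun u hu => le_iInf₂ fun v hv => le_iInf fun huv => ?_
  rw [hammingDist_eq_hammingNorm]
  exact_mod_cast hw _ (C.add_mem (C.neg_mem hu) hv) fun h0 => huv (neg_add_eq_zero.mp h0)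

theorem minDist_le_hammingNorm {c : ι → F} (hc : c ∈ C) (h0 : c ≠ 0) :
    minDist C ≤ (hammingNorm c : ℕ∞) := by
  rw [← hammingDist_zero_right]
  exact iInf₂_le_of_le c hc <| iInf₂_le_of_le 0 C.zero_mem <| iInf_le_of_le h0 le_rfl

theorem minDist_anti {D : Submodule F (ι → F)} (hCD : C ≤ D) : minDist D ≤ minDist C :=
  iInf_mono fun _ => iInf_mono' fun hu =>
    ⟨hCD hu, iInf_mono fun _ => iInf_mono' fun hv => ⟨hCD hv, le_rfl⟩⟩

end MinDist

section PrakashBound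

theorem prakashBound_mul {r δ M : ℕ} (hr : 1 ≤ r) :
    prakashBound ((r + δ - 1) * M) (r * M) r δ = δ := by
  have hr' : (r : ℚ) ≠ 0 := by positivity
  have hceil : ⌈((r * M : ℕ) : ℚ) / (r : ℚ)⌉ = M := by
    rw [Nat.cast_mul, mul_div_cancel_left₀ _ hr', Int.ceil_natCast]
  rw [prakashBound, hceil]
  push_cast [Nat.cast_sub (show 1 ≤ r + δ by omega)]
  ring

theorem prakashBound_of_add_one_eq_mul {r δ M k : ℕ} (hr : 2 ≤ r) (hk : k + 1 = r * M) :
    prakashBound ((r + δ - 1) * M) k r δ = δ + 1 := by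
  have hr' : (2 : ℚ) ≤ r := by exact_mod_cast hr
  have hk' : (k : ℚ) = r * M - 1 := eq_sub_of_add_eq (by exact_mod_cast hk)
  have hceil : ⌈(k : ℚ) / (r : ℚ)⌉ = M := by
    rw [Int.ceil_eq_iff, lt_div_iff₀ (by linarith), div_le_iff₀ (by linarith), Int.cast_natCast]
    constructor <;> linarith
  have hkz : (k : ℤ) = r * M - 1 := eq_sub_of_add_eq (by exact_mod_cast hk)
  rw [prakashBound, hceil, hkz]
  push_cast [Nat.cast_sub (show 1 ≤ r + δ by omega)]
  ring

theorem prakashBound_one (δ k : ℕ) : prakashBound (δ * (k + 1)) k 1 δ = 2 * δ := by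
  have hceil : ⌈(k : ℚ) / ((1 : ℕ) : ℚ)⌉ = k := by simp
  rw [prakashBound, hceil]
  push_cast
  ring

end PrakashBound

section EvalMap

variable {F : Type*} [Field F] {n : ℕ}

@[simp]
theorem evalMap_apply (X : Finset (Fin n → F)) (f : MvPolynomial (Fin n) F) (x : X) :
    evalMap X f x = eval (x : Fin n → F) f := by
  simp [evalMap, aeval_eq_eval]

theorem card_subtype_evalMap_ne_zero [DecidableEq F] {X Y : Finset (Fin n → F)} (hYX : Y ⊆ X)
    (f : MvPolynomial (Fin n) F) :
    #{x ∈ Y.subtype (· ∈ X) | evalMap X f x ≠ 0} = #{y ∈ Y | eval y f ≠ 0} := by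
  rw [← card_map (Embedding.subtype (· ∈ X))]
  congr 1
  ext y
  simpa [and_comm] using fun _ hy => hYX hy

theorem hammingNorm_evalMap [DecidableEq F] (X : Finset (Fin n → F)) (f : MvPolynomial (Fin n) F) :
    hammingNorm (evalMap X f) = #{x ∈ X | eval x f ≠ 0} := by
  rw [← card_subtype_evalMap_ne_zero Subset.rfl, hammingNorm]
  congr 1
  ext x
  simp

theorem evalMap_ne_zero_iff {X : Finset (Fin n → F)} {f : MvPolynomial (Fin n) F} :
    evalMap X f ≠ 0 ↔ ∃ x ∈ X, eval x f ≠ 0 := by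
  simp [ne_iff]

end EvalMap

section ThinGrid

variable {α : Type*} {n : ℕ} {K : Fin n → Finset α} {s : Fin n} {T : Finset α}

theorem card_cartesian (K : Fin n → Finset α) (s : Fin n) :
    #(cartesian K) = #(K s) * ∏ i ∈ univ.erase s, #(K i) := by
  rw [cartesian, Fintype.card_piFinset, mul_prod_erase univ (fun i => #(K i)) (mem_univ s)]

theorem coordLine_subset_cartesian {x : Fin n → α} (hx : x ∈ cartesian K) :
    coordLine (K s) s x ⊆ cartesian K :=
  coordLine_subset_piFinset subset_rfl fun i _ => Fintype.mem_piFinset.mp hx i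

theorem cartesian_update_subset (hT : T ⊆ K s) : cartesian (update K s T) ⊆ cartesian K :=
  Fintype.piFinset_subset _ _ (update_le_iff.mpr ⟨hT, fun _ _ => le_rfl⟩)

theorem coordLine_subset_cartesian_update {x : Fin n → α} (hx : x ∈ cartesian K) (T : Finset α) :
    coordLine T s x ⊆ cartesian (update K s T) := by
  refine coordLine_subset_piFinset (by rw [update_self]) fun i hi => ?_
  rw [update_of_ne hi]
  exact Fintype.mem_piFinset.mp hx i

theorem card_cartesian_update (K : Fin n → Finset α) (s : Fin n) (T : Finset α) :
    #(cartesian (update K s T)) = #T * ∏ i ∈ univ.erase s, #(K i) := by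
  rw [card_cartesian _ s, update_self]
  congr 1
  exact prod_congr rfl fun i hi => by rw [update_of_ne (ne_of_mem_erase hi)]

theorem degree_topExponent_update {δ : ℕ} (hT : #T = #(K s) - δ + 1) :
    (topExponent (update K s T)).degree = dTilde K δ s := by
  rw [degree_topExponent, ← sum_erase_add univ _ (mem_univ s), update_self, hT, dTilde,
    Nat.add_sub_cancel]
  congr 1
  exact sum_congr rfl fun i hi => by rw [update_of_ne (ne_of_mem_erase hi)]

theorem card_Iic_topExponent_update (hK : ∀ i, (K i).Nonempty) {r : ℕ} (hT : #T = r + 1) :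
    #(Iic (topExponent (update K s T))) = (r + 1) * ∏ i ∈ univ.erase s, #(K i) := by
  have hne : ∀ i, (update K s T i).Nonempty :=
    (forall_update_iff K fun _ A => A.Nonempty).mpr
      ⟨card_pos.mp (hT ▸ Nat.succ_pos r), fun i _ => hK i⟩
  rw [card_Iic_topExponent hne, ← hT, ← card_cartesian_update, cartesian, Fintype.card_piFinset]

end ThinGrid

section Code

variable {F : Type*} [Field F] {n : ℕ} {K : Fin n → Finset F} {δ : ℕ} {s : Fin n} {d : ℕ}

theorem mem_quasiAffineCode_iff (hs : δ ≤ #(K s)) {c : cartesian K → F} :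
    c ∈ quasiAffineCode K δ s d ↔ ∃ f : MvPolynomial (Fin n) F,
      f.totalDegree ≤ d ∧ f.degreeOf s + δ ≤ #(K s) ∧ evalMap (cartesian K) f = c := by
  constructor
  · rintro ⟨f, rfl | ⟨hd, hdegs⟩, rfl⟩
    · exact ⟨0, by simp, by simpa using hs, rfl⟩
    · exact ⟨f, hd, by omega, rfl⟩
  · rintro ⟨f, hd, hdegs, rfl⟩
    exact ⟨f, Or.inr ⟨hd, by omega⟩, rfl⟩

theorem quasiAffineCode_mono {δ' d' : ℕ} (hδ : δ' ≤ δ) (hd : d ≤ d') :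
    quasiAffineCode K δ s d ≤ quasiAffineCode K δ' s d' :=
  Submodule.map_mono fun _ => Or.imp_right fun hf => ⟨hf.1.trans hd, by omega⟩

theorem le_card_coordLine_ne_zero [DecidableEq F] {f : MvPolynomial (Fin n) F}
    (hf : f.degreeOf s + δ ≤ #(K s)) {x : Fin n → F} (hfx : eval x f ≠ 0) :
    δ ≤ #{y ∈ coordLine (K s) s x | eval y f ≠ 0} := by
  have := card_le_degreeOf_add_card_coordLine_ne_zero hfx (K s) s
  omega

theorem isLocallyRecoverable_quasiAffineCode [DecidableEq F] (hK : ∀ i, (K i).Nonempty)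
    (hδ : 2 ≤ δ) (hs : δ ≤ #(K s)) :
    IsLocallyRecoverable (quasiAffineCode K δ s d) (#(K s) - δ + 1) δ := by
  have hr : #(K s) - δ + 1 + δ - 1 = #(K s) := by omega
  refine ⟨by omega, hδ, ?_, fun x => ?_⟩
  · rw [hr, Fintype.card_coe, card_cartesian K s]
    exact Nat.le_mul_of_pos_right _ (prod_pos fun i _ => (hK i).card_pos)
  have hline := coordLine_subset_cartesian (s := s) x.2
  refine ⟨(coordLine (K s) s x).subtype (· ∈ cartesian K), ?_, ?_, le_minDist ?_⟩
  · rw [mem_subtype, mem_coordLine]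
    exact ⟨Fintype.mem_piFinset.mp x.2 s, fun _ _ => rfl⟩
  · rw [hr, card_subtype]
    exact (card_filter_le _ _).trans_eq (card_map _)
  · rintro _ ⟨c, hc, rfl⟩ h0
    obtain ⟨f, -, hf, rfl⟩ := (mem_quasiAffineCode_iff hs).mp hc
    obtain ⟨⟨y, hy⟩, hfy⟩ := ne_iff.mp h0
    rw [LinearMap.funLeft_apply, evalMap_apply, Pi.zero_apply] at hfy
    rw [hammingNorm_funLeft_val, card_subtype_evalMap_ne_zero hline,
      ← coordLine_eq_of_mem (mem_subtype.mp hy)]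
    exact le_card_coordLine_ne_zero hf hfy

theorem le_minDist_quasiAffineCode_of_forall [DecidableEq F] (hs : δ ≤ #(K s)) {w : ℕ}
    (hw : ∀ f : MvPolynomial (Fin n) F, f.totalDegree ≤ d → f.degreeOf s + δ ≤ #(K s) →
      ∀ x ∈ cartesian K, eval x f ≠ 0 → w ≤ #{y ∈ cartesian K | eval y f ≠ 0}) :
    (w : ℕ∞) ≤ minDist (quasiAffineCode K δ s d) := by
  refine le_minDist fun c hc h0 => ?_
  obtain ⟨f, hd, hf, rfl⟩ := (mem_quasiAffineCode_iff hs).mp hc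
  obtain ⟨x, hx, hfx⟩ := evalMap_ne_zero_iff.mp h0
  rw [hammingNorm_evalMap]
  exact hw f hd hf x hx hfx

theorem le_minDist_quasiAffineCode [DecidableEq F] (hs : δ ≤ #(K s)) :
    (δ : ℕ∞) ≤ minDist (quasiAffineCode K δ s d) :=
  le_minDist_quasiAffineCode_of_forall hs fun _ _ hf _ hx hfx =>
    (le_card_coordLine_ne_zero hf hfx).trans
      (card_le_card (filter_subset_filter _ (coordLine_subset_cartesian hx)))

theorem minDist_quasiAffineCode_le_prod [DecidableEq F] {u : Fin n → ℕ} (hu : ∀ i, u i ≠ 0)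
    (huK : ∀ i, u i ≤ #(K i)) (hδ : δ ≤ u s) (hd : ∑ i, (#(K i) - u i) ≤ d) :
    minDist (quasiAffineCode K δ s d) ≤ (∏ i, u i : ℕ) := by
  choose T hTK hT using fun i => exists_subset_card_eq (Nat.sub_le #(K i) (u i))
  have hnorm : hammingNorm (evalMap (cartesian K) (vanishingProduct T)) = ∏ i, u i := by
    have hsupport : {x ∈ cartesian K | eval x (vanishingProduct T) ≠ 0} =
        Fintype.piFinset fun i => K i \ T i := by
      ext x
      simp only [cartesian, mem_filter, eval_vanishingProduct_ne_zero_iff, Fintype.mem_piFinset,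
        mem_sdiff, forall_and]
    rw [hammingNorm_evalMap, hsupport, Fintype.card_piFinset]
    refine prod_congr rfl fun i _ => ?_
    rw [card_sdiff_of_subset (hTK i), hT, Nat.sub_sub_self (huK i)]
  rw [← hnorm]
  refine minDist_le_hammingNorm ((mem_quasiAffineCode_iff (hδ.trans (huK s))).mpr
    ⟨_, (totalDegree_vanishingProduct_le T).trans ?_, ?_, rfl⟩) ?_
  · simpa only [hT] using hd
  · have := degreeOf_vanishingProduct_le T s
    have := huK s
    rw [hT] at *
    omega
  · rw [← hammingNorm_ne_zero_iff, hnorm]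
    exact prod_ne_zero_iff.mpr fun i _ => hu i

theorem finrank_quasiAffineCode_le (hδ : 1 ≤ δ) (hs : δ ≤ #(K s)) :
    Module.finrank F (quasiAffineCode K δ s d) ≤
      (#(K s) - δ + 1) * ∏ i ∈ univ.erase s, #(K i) := by
  classical
  obtain ⟨T, hTK, hT⟩ := exists_subset_card_eq (s := K s) (n := #(K s) - δ + 1) (by omega)
  have hsub := cartesian_update_subset hTK
  calc Module.finrank F (quasiAffineCode K δ s d)
      ≤ #((cartesian (update K s T)).subtype (· ∈ cartesian K)) :=
        finrank_le_card_of_forall_eq_zero _ fun c hc hcT => ?_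
    _ = #(cartesian (update K s T)) := by
        rw [card_subtype, filter_true_of_mem fun x hx => hsub hx]
    _ = (#(K s) - δ + 1) * ∏ i ∈ univ.erase s, #(K i) := by rw [card_cartesian_update, hT]
  obtain ⟨f, -, hf, rfl⟩ := (mem_quasiAffineCode_iff hs).mp hc
  by_contra hne
  obtain ⟨x, hx, hfx⟩ := evalMap_ne_zero_iff.mp hne
  have hline : {y ∈ coordLine T s x | eval y f ≠ 0} = ∅ := by
    refine filter_eq_empty_iff.mpr fun y hy => not_not.mpr ?_
    have hyT : y ∈ cartesian (update K s T) := coordLine_subset_cartesian_update hx T hy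
    simpa using hcT ⟨y, hsub hyT⟩ (mem_subtype.mpr hyT)
  have := card_le_degreeOf_add_card_coordLine_ne_zero hfx T s
  rw [hline, card_empty] at this
  omega

theorem card_le_finrank_quasiAffineCode (hK : ∀ i, (K i).Nonempty) (hs : δ ≤ #(K s))
    {T : Finset F} (hTK : T ⊆ K s) (hT : #T = #(K s) - δ + 1) {A : Finset (Fin n →₀ ℕ)}
    (hA : A ⊆ Iic (topExponent (update K s T))) (hd : ∀ e ∈ A, e.degree ≤ d) :
    #A ≤ Module.finrank F (quasiAffineCode K δ s d) := by
  have hreduced {e : Fin n →₀ ℕ} (he : e ∈ A) : e ≤ topExponent K :=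
    (mem_Iic.mp (hA he)).trans (topExponent_mono (update_le_iff.mpr ⟨hTK, fun _ _ => le_rfl⟩))
  have hthin {e : Fin n →₀ ℕ} (he : e ∈ A) : e s ≤ #(K s) - δ := by
    simpa [hT] using mem_Iic.mp (hA he) s
  let V := restrictSupport F (A : Set (Fin n →₀ ℕ))
  have hinj : Injective ((evalMap (cartesian K)).domRestrict V) := by
    rw [← LinearMap.ker_eq_bot, LinearMap.ker_eq_bot']
    rintro ⟨f, hf⟩ h0
    ext1
    refine eq_zero_of_eval_zero_at_prod_finset f K (fun i => ?_) fun x hx => ?_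
    · rw [degreeOf_lt_iff (hK i).card_pos]
      exact fun e he => lt_card_of_le_topExponent hK (hreduced (hf he)) i
    · simpa using congrFun h0 ⟨x, Fintype.mem_piFinset.mpr hx⟩
  have hV : V ≤ polySpace K δ s d := fun f hf => by
    have htotal : f.totalDegree ≤ d := Finset.sup_le fun e he => hd e (hf he)
    have hdegs : f.degreeOf s ≤ #(K s) - δ := degreeOf_le_iff.mpr fun e he => hthin (hf he)
    exact Or.inr ⟨htotal, by omega⟩
  calc #A = Module.finrank F V := by
        rw [Module.finrank_eq_card_basis (basisRestrictSupport F (A : Set (Fin n →₀ ℕ)))]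
        simp
    _ = Module.finrank F (V.map (evalMap (cartesian K))) := by
        rw [← LinearMap.range_domRestrict, LinearMap.finrank_range_of_inj hinj]
    _ ≤ Module.finrank F (quasiAffineCode K δ s d) :=
        Submodule.finrank_mono (Submodule.map_mono hV)

theorem finrank_quasiAffineCode_dTilde (hK : ∀ i, (K i).Nonempty) (hδ : 1 ≤ δ)
    (hs : δ ≤ #(K s)) :
    Module.finrank F (quasiAffineCode K δ s (dTilde K δ s)) =
      (#(K s) - δ + 1) * ∏ i ∈ univ.erase s, #(K i) := by
  refine (finrank_quasiAffineCode_le hδ hs).antisymm ?_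
  obtain ⟨T, hTK, hT⟩ := exists_subset_card_eq (s := K s) (n := #(K s) - δ + 1) (by omega)
  rw [← card_Iic_topExponent_update hK hT]
  refine card_le_finrank_quasiAffineCode hK hs hTK hT subset_rfl fun e he => ?_
  rw [← degree_topExponent_update hT]
  exact Finsupp.degree_mono (mem_Iic.mp he)

theorem minDist_quasiAffineCode_dTilde [DecidableEq F] (hK : ∀ i, (K i).Nonempty) (hδ : 1 ≤ δ)
    (hs : δ ≤ #(K s)) : minDist (quasiAffineCode K δ s (dTilde K δ s)) = δ := by
  refine le_antisymm ?_ (le_minDist_quasiAffineCode hs)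
  have hprod : ∏ i, update (1 : Fin n → ℕ) s δ i = δ := by
    simp [prod_update_of_mem]
  have hd : ∑ i, (#(K i) - update (1 : Fin n → ℕ) s δ i) = dTilde K δ s := by
    rw [← sum_erase_add univ _ (mem_univ s), update_self, dTilde]
    congr 1
    exact sum_congr rfl fun i hi => by rw [update_of_ne (ne_of_mem_erase hi), Pi.one_apply]
  conv_rhs => rw [← hprod]
  refine minDist_quasiAffineCode_le_prod (fun i => ?_) (fun i => ?_) (by rw [update_self]) hd.le
  · rcases eq_or_ne i s with rfl | hi
    · rw [update_self]; omega
    · simp [hi]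
  · rcases eq_or_ne i s with rfl | hi
    · simpa using hs
    · simpa [hi, Nat.one_le_iff_ne_zero] using (hK i).ne_empty

/-- Otherwise `f` would be nonzero at exactly one point of a thin grid, although its degree is
smaller than that of the top exponent of that grid. -/
theorem lt_card_coordLine_ne_zero [DecidableEq F] {f : MvPolynomial (Fin n) F}
    (hd : f.totalDegree < dTilde K δ s) {x : Fin n → F} (hx : x ∈ cartesian K)
    (hfx : eval x f ≠ 0)
    (hline : ∀ y ∈ cartesian K, eval y f ≠ 0 → y ∈ coordLine (K s) s x) :
    δ < #{y ∈ coordLine (K s) s x | eval y f ≠ 0} := by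
  by_contra! hle
  rw [card_filter_coordLine] at hle
  have hzeros : #(K s) - δ ≤ #{a ∈ K s | eval (update x s a) f = 0} := by
    rw [Nat.sub_le_iff_le_add,
      ← card_filter_add_card_filter_not (s := K s) fun a => eval (update x s a) f = 0]
    gcongr
  obtain ⟨T₀, hT₀, hcard⟩ := exists_subset_card_eq hzeros
  have hzero {a : F} (ha : a ∈ T₀) : eval (update x s a) f = 0 := (mem_filter.mp (hT₀ ha)).2
  have hxT₀ : x s ∉ T₀ := fun h => hfx (by simpa using hzero h)
  have hT : #(insert (x s) T₀) = #(K s) - δ + 1 := by rw [card_insert_of_notMem hxT₀, hcard]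
  have hTK : insert (x s) T₀ ⊆ K s :=
    insert_subset (Fintype.mem_piFinset.mp hx s) (hT₀.trans (filter_subset _ _))
  have hxT : x ∈ cartesian (update K s (insert (x s) T₀)) :=
    coordLine_subset_cartesian_update hx _ (mem_coordLine.mpr ⟨mem_insert_self _ _, fun _ _ => rfl⟩)
  refine hd.not_ge ?_
  rw [← degree_topExponent_update hT]
  refine degree_topExponent_le_totalDegree hxT hfx fun y hy hyx => ?_
  by_contra hfy
  have hyline := (mem_coordLine.mp (hline y (cartesian_update_subset hTK hy) hfy)).2
  have hyT : y s ∈ insert (x s) T₀ := by simpa using Fintype.mem_piFinset.mp hy s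
  have hy_eq : update x s (y s) = y := update_eq_iff.mpr ⟨rfl, fun i hi => (hyline i hi).symm⟩
  rcases mem_insert.mp hyT with hys | hys
  · exact hyx (by rw [← hy_eq, hys, update_eq_self])
  · exact hfy (hy_eq ▸ hzero hys)

theorem two_mul_le_card_ne_zero [DecidableEq F] {f : MvPolynomial (Fin n) F}
    (hf : f.degreeOf s + δ ≤ #(K s)) {x y : Fin n → F} (hx : x ∈ cartesian K)
    (hy : y ∈ cartesian K) (hfx : eval x f ≠ 0) (hfy : eval y f ≠ 0)
    (hyx : y ∉ coordLine (K s) s x) : 2 * δ ≤ #{z ∈ cartesian K | eval z f ≠ 0} := by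
  have hdisjoint : Disjoint (coordLine (K s) s x) (coordLine (K s) s y) := by
    refine disjoint_left.mpr fun z hzx hzy => hyx ?_
    rw [← coordLine_eq_of_mem hzx, coordLine_eq_of_mem hzy, mem_coordLine]
    exact ⟨Fintype.mem_piFinset.mp hy s, fun _ _ => rfl⟩
  calc 2 * δ ≤ #{z ∈ coordLine (K s) s x | eval z f ≠ 0} +
          #{z ∈ coordLine (K s) s y | eval z f ≠ 0} := by
        rw [two_mul]
        exact add_le_add (le_card_coordLine_ne_zero hf hfx) (le_card_coordLine_ne_zero hf hfy)
    _ = #{z ∈ coordLine (K s) s x ∪ coordLine (K s) s y | eval z f ≠ 0} := by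
        rw [filter_union, card_union_of_disjoint (disjoint_filter_filter hdisjoint)]
    _ ≤ #{z ∈ cartesian K | eval z f ≠ 0} :=
        card_le_card <| filter_subset_filter _ <|
          union_subset (coordLine_subset_cartesian hx) (coordLine_subset_cartesian hy)

theorem lt_card_coordLine_or_two_mul_le_card [DecidableEq F] {f : MvPolynomial (Fin n) F}
    (hd : f.totalDegree < dTilde K δ s) (hf : f.degreeOf s + δ ≤ #(K s)) {x : Fin n → F}
    (hx : x ∈ cartesian K) (hfx : eval x f ≠ 0) :
    δ < #{y ∈ coordLine (K s) s x | eval y f ≠ 0} ∨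
      2 * δ ≤ #{y ∈ cartesian K | eval y f ≠ 0} := by
  by_cases hline : ∀ y ∈ cartesian K, eval y f ≠ 0 → y ∈ coordLine (K s) s x
  · exact Or.inl (lt_card_coordLine_ne_zero hd hx hfx hline)
  · push Not at hline
    obtain ⟨y, hy, hfy, hyx⟩ := hline
    exact Or.inr (two_mul_le_card_ne_zero hf hx hy hfx hfy hyx)

theorem minDist_quasiAffineCode_dTilde_sub_one_of_lt [DecidableEq F] (hK : ∀ i, (K i).Nonempty)
    (hδ : 1 ≤ δ) (hs : δ < #(K s)) :
    minDist (quasiAffineCode K δ s (dTilde K δ s - 1)) = (δ + 1 : ℕ) := by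
  have hdTilde : dTilde K (δ + 1) s = dTilde K δ s - 1 ∧ 1 ≤ dTilde K δ s := by
    unfold dTilde
    omega
  refine le_antisymm ?_ (le_minDist_quasiAffineCode_of_forall hs.le fun f hd hf x hx hfx => ?_)
  · rw [← minDist_quasiAffineCode_dTilde hK (Nat.le_add_left 1 δ) hs]
    exact minDist_anti (quasiAffineCode_mono (Nat.le_succ δ) hdTilde.1.le)
  · rcases lt_card_coordLine_or_two_mul_le_card (by omega) hf hx hfx with hlt | hle
    · exact hlt.trans_le (card_le_card (filter_subset_filter _ (coordLine_subset_cartesian hx)))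
    · omega

theorem minDist_quasiAffineCode_dTilde_sub_one_le [DecidableEq F] (hK : ∀ i, (K i).Nonempty)
    (hδ : 1 ≤ δ) (hs : δ ≤ #(K s)) {j : Fin n} (hjs : j ≠ s) (hj : 2 ≤ #(K j)) :
    minDist (quasiAffineCode K δ s (dTilde K δ s - 1)) ≤ (2 * δ : ℕ) := by
  set u : Fin n → ℕ := update (update 1 s δ) j 2 with hu
  have hus : u s = δ := by rw [hu, update_of_ne hjs.symm, update_self]
  have huj : u j = 2 := update_self ..
  have hu_of_ne {i : Fin n} (his : i ≠ s) (hij : i ≠ j) : u i = 1 := by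
    rw [hu, update_of_ne hij, update_of_ne his, Pi.one_apply]
  have hprod : ∏ i, u i = 2 * δ := by
    rw [hu, prod_update_of_mem (mem_univ j), prod_update_of_mem (by simpa using hjs.symm)]
    simp
  have hbounds (i : Fin n) : u i ≠ 0 ∧ u i ≤ #(K i) := by
    have := (hK i).card_pos
    rcases eq_or_ne i s with rfl | his
    · omega
    · rcases eq_or_ne i j with rfl | hij
      · omega
      · rw [hu_of_ne his hij]
        omega
  have hdegree : ∑ i, (#(K i) - u i) = dTilde K δ s - 1 := by
    have hj_mem : j ∈ univ.erase s := mem_erase.mpr ⟨hjs, mem_univ j⟩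
    have hrest : ∑ i ∈ (univ.erase s).erase j, (#(K i) - u i) =
        ∑ i ∈ (univ.erase s).erase j, (#(K i) - 1) :=
      sum_congr rfl fun i hi => by
        rw [hu_of_ne (ne_of_mem_erase (mem_of_mem_erase hi)) (ne_of_mem_erase hi)]
    rw [dTilde, ← sum_erase_add univ _ (mem_univ s), ← add_sum_erase _ _ hj_mem,
      ← add_sum_erase _ _ hj_mem, hus, huj, hrest]
    omega
  rw [← hprod]
  exact minDist_quasiAffineCode_le_prod (fun i => (hbounds i).1) (fun i => (hbounds i).2)
    hus.ge hdegree.le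

theorem minDist_quasiAffineCode_dTilde_sub_one_of_eq [DecidableEq F] (hK : ∀ i, (K i).Nonempty)
    (hδ : 1 ≤ δ) (hs : δ = #(K s)) (hd : 1 ≤ dTilde K δ s) :
    minDist (quasiAffineCode K δ s (dTilde K δ s - 1)) = (2 * δ : ℕ) := by
  refine le_antisymm ?_ (le_minDist_quasiAffineCode_of_forall hs.le fun f hfd hf x hx hfx => ?_)
  · obtain ⟨j, hj, hKj⟩ : ∃ j ∈ univ.erase s, #(K j) - 1 ≠ 0 := by
      refine exists_ne_zero_of_sum_ne_zero ?_
      rw [dTilde] at hd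
      omega
    exact minDist_quasiAffineCode_dTilde_sub_one_le hK hδ hs.le (ne_of_mem_erase hj) (by omega)
  · refine (lt_card_coordLine_or_two_mul_le_card (by omega) hf hx hfx).resolve_left ?_
    rw [not_lt, hs]
    exact (card_filter_le _ _).trans_eq (card_map _)

theorem minDist_quasiAffineCode_dTilde_lt_sub_one [DecidableEq F] (hK : ∀ i, (K i).Nonempty)
    (hδ : 1 ≤ δ) (hs : δ ≤ #(K s)) (hd : 1 ≤ dTilde K δ s) :
    minDist (quasiAffineCode K δ s (dTilde K δ s)) <
      minDist (quasiAffineCode K δ s (dTilde K δ s - 1)) := by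
  rw [minDist_quasiAffineCode_dTilde hK hδ hs]
  rcases hs.lt_or_eq with hlt | heq
  · rw [minDist_quasiAffineCode_dTilde_sub_one_of_lt hK hδ hlt]
    exact_mod_cast Nat.lt_succ_self δ
  · rw [minDist_quasiAffineCode_dTilde_sub_one_of_eq hK hδ heq hd]
    exact_mod_cast (by omega : δ < 2 * δ)

theorem finrank_quasiAffineCode_dTilde_sub_one (hK : ∀ i, (K i).Nonempty) (hδ : 1 ≤ δ)
    (hs : δ ≤ #(K s)) (hd : 1 ≤ dTilde K δ s) :
    Module.finrank F (quasiAffineCode K δ s (dTilde K δ s - 1)) + 1 =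
      (#(K s) - δ + 1) * ∏ i ∈ univ.erase s, #(K i) := by
  classical
  refine le_antisymm ?_ ?_
  · rw [← finrank_quasiAffineCode_dTilde hK hδ hs]
    refine Submodule.finrank_lt_finrank_of_lt
      ((quasiAffineCode_mono le_rfl (Nat.sub_le _ 1)).lt_of_ne fun heq => ?_)
    exact (minDist_quasiAffineCode_dTilde_lt_sub_one hK hδ hs hd).ne (by rw [heq])
  · obtain ⟨T, hTK, hT⟩ := exists_subset_card_eq (s := K s) (n := #(K s) - δ + 1) (by omega)
    rw [← card_Iic_topExponent_update hK hT, ← Iio_insert, card_insert_of_notMem (by simp)]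
    gcongr
    refine card_le_finrank_quasiAffineCode hK hs hTK hT Iio_subset_Iic_self fun e he => ?_
    rw [← degree_topExponent_update hT]
    exact Nat.le_sub_one_of_lt (degree_strictMono (mem_Iio.mp he))

theorem isOptimal_quasiAffineCode_dTilde [DecidableEq F] (hK : ∀ i, (K i).Nonempty) (hδ : 2 ≤ δ)
    (hs : δ ≤ #(K s)) :
    IsOptimal (quasiAffineCode K δ s (dTilde K δ s)) (#(K s) - δ + 1) δ := by
  refine ⟨isLocallyRecoverable_quasiAffineCode hK hδ hs, δ,
    minDist_quasiAffineCode_dTilde hK (by omega) hs, ?_⟩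
  have hlength : Fintype.card (cartesian K) =
      (#(K s) - δ + 1 + δ - 1) * ∏ i ∈ univ.erase s, #(K i) := by
    rw [Fintype.card_coe, card_cartesian K s]
    congr 1
    omega
  rw [hlength, finrank_quasiAffineCode_dTilde hK (by omega) hs, prakashBound_mul (by omega)]

theorem isOptimal_quasiAffineCode_dTilde_sub_one [DecidableEq F] (hK : ∀ i, (K i).Nonempty)
    (hδ : 2 ≤ δ) (hs : δ ≤ #(K s)) (hd : 1 ≤ dTilde K δ s) :
    IsOptimal (quasiAffineCode K δ s (dTilde K δ s - 1)) (#(K s) - δ + 1) δ := by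
  refine ⟨isLocallyRecoverable_quasiAffineCode hK hδ hs, ?_⟩
  have hdim := finrank_quasiAffineCode_dTilde_sub_one hK (by omega) hs hd
  rw [Fintype.card_coe, card_cartesian K s]
  rcases hs.lt_or_eq with hlt | heq
  · refine ⟨δ + 1, minDist_quasiAffineCode_dTilde_sub_one_of_lt hK (by omega) hlt, ?_⟩
    have hlength : #(K s) = #(K s) - δ + 1 + δ - 1 := by omega
    nth_rewrite 1 [hlength]
    rw [prakashBound_of_add_one_eq_mul (by omega) hdim]
    push_cast
    rfl
  · refine ⟨2 * δ, minDist_quasiAffineCode_dTilde_sub_one_of_eq hK (by omega) heq hd, ?_⟩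
    rw [← heq, Nat.sub_self, zero_add, one_mul] at hdim
    rw [← heq, ← hdim, Nat.sub_self, zero_add, prakashBound_one]
    push_cast
    rfl

end Code

end CartesianCode

theorem corollary4p2_general {F : Type*} [Field F] [DecidableEq F] {n : ℕ}
    (K : Fin n → Finset F) (hK : ∀ i, (K i).Nonempty) (s : Fin n) (δ : ℕ)
    (hδ : 2 ≤ δ) (hs : δ ≤ (K s).card) :
    (CartesianCode.IsOptimal
        (CartesianCode.quasiAffineCode K δ s (CartesianCode.dTilde K δ s))
        ((K s).card - δ + 1) δ ∧
      CartesianCode.minDist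
        (CartesianCode.quasiAffineCode K δ s (CartesianCode.dTilde K δ s)) = (δ : ℕ∞)) ∧
    (1 ≤ CartesianCode.dTilde K δ s →
      CartesianCode.IsOptimal
        (CartesianCode.quasiAffineCode K δ s (CartesianCode.dTilde K δ s - 1))
        ((K s).card - δ + 1) δ ∧
      (δ < (K s).card →
        CartesianCode.minDist
          (CartesianCode.quasiAffineCode K δ s (CartesianCode.dTilde K δ s - 1)) =
            ((δ + 1 : ℕ) : ℕ∞))) := by
  refine ⟨⟨CartesianCode.isOptimal_quasiAffineCode_dTilde hK hδ hs,
    CartesianCode.minDist_quasiAffineCode_dTilde hK (by omega) hs⟩, fun hd => ?_⟩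
  exact ⟨CartesianCode.isOptimal_quasiAffineCode_dTilde_sub_one hK hδ hs hd,
    CartesianCode.minDist_quasiAffineCode_dTilde_sub_one_of_lt hK (by omega)⟩

/-- Here `|K s| - δ + 1` is the locality parameter `r`. The hypothesis `1 ≤ dTilde K δ s` only
says that the order `dTilde K δ s - 1` is nonnegative. -/
theorem corollary4p2 {F : Type*} [Field F] [Fintype F] [DecidableEq F] {n : ℕ}
    (K : Fin n → Finset F) (hK : ∀ i, (K i).Nonempty) (s : Fin n) (δ : ℕ)
    (hδ : 2 ≤ δ) (hs : δ ≤ (K s).card) :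
    (CartesianCode.IsOptimal
        (CartesianCode.quasiAffineCode K δ s (CartesianCode.dTilde K δ s))
        ((K s).card - δ + 1) δ ∧
      CartesianCode.minDist
        (CartesianCode.quasiAffineCode K δ s (CartesianCode.dTilde K δ s)) = (δ : ℕ∞)) ∧
    (1 ≤ CartesianCode.dTilde K δ s →
      CartesianCode.IsOptimal
        (CartesianCode.quasiAffineCode K δ s (CartesianCode.dTilde K δ s - 1))
        ((K s).card - δ + 1) δ ∧
      (δ < (K s).card →
        CartesianCode.minDist
          (CartesianCode.quasiAffineCode K δ s (CartesianCode.dTilde K δ s - 1)) =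
            ((δ + 1 : ℕ) : ℕ∞))) := by
  exact corollary4p2_general K hK s δ hδ hs
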